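/- Let $G$ be a finite group, let $\mathcal C$ be the set of its conjugacy classes, let $\mathfrak r:\mathcal C\to\mathbb N$, $C\mapsto \mathfrak r_C$, be a function (a ramification data of $G$, with $\mathbb N$ the nonnegative integers) that is not identically zero, and let $K$ be any field. Let $S_{G,\mathfrak r}$ be the subsemigroup of $G$ generated by $\bigcup_{C\in\mathcal C,\ \mathfrak r_C>0} C$. Let $\Gamma_{G,\mathfrak r}$ be the Hopf graph of $(G,\mathfrak r)$: the directed graph with vertex set $G$ that has, for each $x\in G$, each $C\in\mathcal C$ and each $c\in C$, exactly $\mathfrak r_C$ edges from $x$ to $xc$. For a directed graph $E$ with source and range maps $s,r:E^1\to E^0$, the Leavitt path algebra $L_K(E)$ is the (not necessarily unital) associative $K$-algebra generated by the set $E^0\sqcup E^1\sqcup\{e^*: e\in E^1\}$ subject to the relations, for all $v,w\in E^0$ and $e,f\in E^1$: $vw=\delta_{v,w}w$; $s(e)e=e=e\,r(e)$ and $r(e)e^*=e^*=e^*s(e)$; $e^*f=\delta_{e,f}\,r(e)$; and $v=\sum_{e\in s^{-1}(v)}ee^*$ whenever $s^{-1}(v)$ is finite and nonempty. An idempotent $e$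 of a ring $R$ is called infinite if $eR$ is isomorphic, as a right $R$-module, to a proper direct summand of itself; $R$ is called purely infinite if every nonzero right ideal of $R$ contains an infinite idempotent, and purely infinite simple if it is both purely infinite and simple. Then the following statements are equivalent: 1. $L_K(\Gamma_{G,\mathfrak r})$ is purely infinite simple; 2. $L_K(\Gamma_{G,\mathfrak r})$ is simple; 3. $S_{G,\mathfrak r}=G$ and $\sum_{C\in\mathcal C}\mathfrak r_C|C|\ge 2$. -/

import Mathlib

universe u v w

/-! ### Directed graphs -/

/-- A directed graph `(E⁰, E¹, r, s)`; loops and multiple edges are allowed. -/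
structure DirectedGraph where
  /-- the vertices -/
  Vert : Type u
  /-- the edges -/
  Edge : Type v
  /-- the source of an edge -/
  src : Edge → Vert
  /-- the range of an edge -/
  rng : Edge → Vert

/-! ### Leavitt path algebras -/

/-- The generators of the Leavitt path algebra: the vertices, the edges and the ghost edges. -/
inductive LeavittGen (E : DirectedGraph.{u, v}) : Type (max u v)
  | vert (x : E.Vert)
  | edge (e : E.Edge)
  | ghost (e : E.Edge)

/-- The free associative (non-unital) `K`-algebra on the generators of the Leavitt path algebra. It
is the semigroup algebra of the free semigroup, that is, it has the nonempty words as a basis. -/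
abbrev FreeLeavitt (K : Type w) [Field K] (E : DirectedGraph.{u, v}) : Type (max u v w) :=
  MonoidAlgebra K (FreeSemigroup (LeavittGen E))

/-- A generator as an element of the free algebra. -/
noncomputable def FreeLeavitt.gen (K : Type w) [Field K] {E : DirectedGraph.{u, v}}
    (x : LeavittGen E) : FreeLeavitt K E :=
  MonoidAlgebra.single (FreeSemigroup.of x) 1

open FreeLeavitt LeavittGen in
/-- The defining relations of the Leavitt path algebra. A vertex `v` is regular if `s⁻¹(v)` is
finite and nonempty. -/
inductive LeavittRel (K : Type w) [Field K] (E : DirectedGraph.{u, v}) :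
    FreeLeavitt K E → FreeLeavitt K E → Prop
  | vert_mul_self (x : E.Vert) : LeavittRel K E (gen K (vert x) * gen K (vert x)) (gen K (vert x))
  | vert_mul_vert (x y : E.Vert) : x ≠ y → LeavittRel K E (gen K (vert x) * gen K (vert y)) 0
  | src_mul_edge (e : E.Edge) :
      LeavittRel K E (gen K (vert (E.src e)) * gen K (edge e)) (gen K (edge e))
  | edge_mul_rng (e : E.Edge) :
      LeavittRel K E (gen K (edge e) * gen K (vert (E.rng e))) (gen K (edge e))
  | rng_mul_ghost (e : E.Edge) :
      LeavittRel K E (gen K (vert (E.rng e)) * gen K (ghost e)) (gen K (ghost e))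
  | ghost_mul_src (e : E.Edge) :
      LeavittRel K E (gen K (ghost e) * gen K (vert (E.src e))) (gen K (ghost e))
  | ghost_mul_edge_self (e : E.Edge) :
      LeavittRel K E (gen K (ghost e) * gen K (edge e)) (gen K (vert (E.rng e)))
  | ghost_mul_edge (e f : E.Edge) : e ≠ f →
      LeavittRel K E (gen K (ghost e) * gen K (edge f)) 0
  | sum_edge_mul_ghost (x : E.Vert) (hfin : {e : E.Edge | E.src e = x}.Finite)
      (hne : {e : E.Edge | E.src e = x}.Nonempty) :
      LeavittRel K E (gen K (vert x)) (∑ e ∈ hfin.toFinset, gen K (edge e) * gen K (ghost e))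

/-- The algebra congruence generated by the defining relations. Scalar multiples of the relations
are thrown in because the free algebra has no unit, so that a congruence that respects sums and
products does not automatically respect scalar multiplication. -/
noncomputable def leavittCon (K : Type w) [Field K] (E : DirectedGraph.{u, v}) :
    RingCon (FreeLeavitt K E) :=
  ringConGen fun a b => ∃ (c : K) (x y : FreeLeavitt K E), LeavittRel K E x y ∧
    a = c • x ∧ b = c • y

theorem leavittCon_smul {K : Type w} [Field K] {E : DirectedGraph.{u, v}} (c : K)
    {a b : FreeLeavitt K E} (h : leavittCon K E a b) : leavittCon K E (c • a) (c • b) := by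
  have h' : RingConGen.Rel _ a b := h
  induction h' with
  | of x y hxy =>
    obtain ⟨d, x', y', hr, rfl, rfl⟩ := hxy
    exact RingConGen.Rel.of _ _ ⟨c * d, x', y', hr, (mul_smul c d x').symm, (mul_smul c d y').symm⟩
  | refl x => exact (leavittCon K E).refl _
  | symm h₁ ih => exact (leavittCon K E).symm (ih h₁)
  | trans h₁ h₂ ih₁ ih₂ => exact (leavittCon K E).trans (ih₁ h₁) (ih₂ h₂)
  | add h₁ h₂ ih₁ ih₂ =>
    rw [smul_add, smul_add]
    exact (leavittCon K E).add (ih₁ h₁) (ih₂ h₂)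
  | mul h₁ h₂ ih₁ ih₂ =>
    rw [← smul_mul_assoc, ← smul_mul_assoc]
    exact (leavittCon K E).mul (ih₁ h₁) h₂

/-- The Leavitt path algebra `L_K(E)`: the (not necessarily unital) associative `K`-algebra
presented by the vertices, edges and ghost edges of `E` and the relations `LeavittRel`. -/
def LeavittPathAlgebra (K : Type w) [Field K] (E : DirectedGraph.{u, v}) : Type (max u v w) :=
  (leavittCon K E).Quotient

namespace LeavittPathAlgebra

noncomputable instance (K : Type w) [Field K] (E : DirectedGraph.{u, v}) :
    NonUnitalRing (LeavittPathAlgebra K E) :=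
  inferInstanceAs (NonUnitalRing (leavittCon K E).Quotient)

/-- The quotient map from the free algebra, as a ring homomorphism. -/
noncomputable def mk (K : Type w) [Field K] (E : DirectedGraph.{u, v}) :
    FreeLeavitt K E →ₙ+* LeavittPathAlgebra K E where
  toFun a := (leavittCon K E).toQuotient a
  map_zero' := rfl
  map_add' _ _ := rfl
  map_mul' _ _ := rfl

theorem mk_surjective (K : Type w) [Field K] (E : DirectedGraph.{u, v}) :
    Function.Surjective (mk K E) :=
  Quotient.mk_surjective

theorem mk_eq_mk {K : Type w} [Field K] {E : DirectedGraph.{u, v}} {a b : FreeLeavitt K E} :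
    mk K E a = mk K E b ↔ leavittCon K E a b :=
  (leavittCon K E).eq

noncomputable instance (K : Type w) [Field K] (E : DirectedGraph.{u, v}) :
    SMul K (LeavittPathAlgebra K E) where
  smul c := Quotient.map (c • ·) fun _ _ h => leavittCon_smul c h

theorem mk_smul {K : Type w} [Field K] {E : DirectedGraph.{u, v}} (c : K) (a : FreeLeavitt K E) :
    mk K E (c • a) = c • mk K E a := rfl

noncomputable instance (K : Type w) [Field K] (E : DirectedGraph.{u, v}) :
    Module K (LeavittPathAlgebra K E) :=
  (mk_surjective K E).module K (mk K E).toAddMonoidHom mk_smul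

instance (K : Type w) [Field K] (E : DirectedGraph.{u, v}) :
    IsScalarTower K (LeavittPathAlgebra K E) (LeavittPathAlgebra K E) where
  smul_assoc c a b := by
    obtain ⟨a, rfl⟩ := mk_surjective K E a
    obtain ⟨b, rfl⟩ := mk_surjective K E b
    simp only [smul_eq_mul, ← mk_smul, ← map_mul, smul_mul_assoc]

instance (K : Type w) [Field K] (E : DirectedGraph.{u, v}) :
    SMulCommClass K (LeavittPathAlgebra K E) (LeavittPathAlgebra K E) where
  smul_comm c a b := by
    obtain ⟨a, rfl⟩ := mk_surjective K E a
    obtain ⟨b, rfl⟩ := mk_surjective K E b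
    simp only [smul_eq_mul, ← mk_smul, ← map_mul, mul_smul_comm]

end LeavittPathAlgebra

/-! ### Purely infinite simple rings

Rings are associative but need not have a unit. -/

/-- A right ideal of `R`. -/
def IsRightIdeal {R : Type u} [NonUnitalRing R] (I : AddSubgroup R) : Prop :=
  ∀ x ∈ I, ∀ a : R, x * a ∈ I

/-- The right ideal `eR = {e * a | a ∈ R}`. -/
def rightMultiples {R : Type u} [NonUnitalRing R] (e : R) : AddSubgroup R :=
  (AddMonoidHom.mulLeft e).range

theorem isRightIdeal_rightMultiples {R : Type u} [NonUnitalRing R] (e : R) :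
    IsRightIdeal (rightMultiples e) := by
  rintro _ ⟨b, rfl⟩ a
  exact ⟨b * a, by simp [mul_assoc]⟩

/-- The right ideals `I` and `J` are isomorphic as right `R`-modules. -/
def RightIdealIso {R : Type u} [NonUnitalRing R] (I J : AddSubgroup R) : Prop :=
  ∃ φ : I ≃+ J, ∀ (x y : I) (a : R), (y : R) = x * a → (φ y : R) = φ x * a

/-- An infinite idempotent: an idempotent `e` such that `eR` is isomorphic, as a right `R`-module,
to a proper direct summand `A` of itself. -/
def IsInfiniteIdempotent {R : Type u} [NonUnitalRing R] (e : R) : Prop :=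
  IsIdempotentElem e ∧ ∃ A B : AddSubgroup R, IsRightIdeal A ∧ IsRightIdeal B ∧
    A ⊔ B = rightMultiples e ∧ A ⊓ B = ⊥ ∧ A ≠ rightMultiples e ∧
    RightIdealIso (rightMultiples e) A

/-- A ring is purely infinite if every nonzero right ideal contains an infinite idempotent. -/
def IsPurelyInfinite (R : Type u) [NonUnitalRing R] : Prop :=
  ∀ I : AddSubgroup R, IsRightIdeal I → I ≠ ⊥ → ∃ e ∈ I, IsInfiniteIdempotent e

/-! ### Hopf graphs -/

/-- Ramification data of a group `G`: a function from the conjugacy classes to `ℕ`. -/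
abbrev RamificationData (G : Type u) [Group G] : Type u := ConjClasses G → ℕ

/-- The Hopf graph `Γ_{G, r}`: the vertices are the elements of `G`, and for all `x c : G` there are
`r_C` edges from `x` to `x * c`, where `C` is the conjugacy class of `c`. -/
def hopfGraph (G : Type u) [Group G] (r : RamificationData G) : DirectedGraph.{u, u} where
  Vert := G
  Edge := Σ p : G × G, Fin (r (ConjClasses.mk p.2))
  src e := e.1.1
  rng e := e.1.1 * e.1.2

/-- The subsemigroup `S_{G, r}` of `G` generated by the union of the conjugacy classes `C` with
`r_C > 0`. -/
def ramificationSemigroup (G : Type u) [Group G] (r : RamificationData G) : Subsemigroup G :=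
  Subsemigroup.closure (⋃ C ∈ {C : ConjClasses G | 0 < r C}, C.carrier)

/-! Each vertex of the Hopf graph emits N = ∑ r_C |C| edges, and N ≥ 1. In a finite group a nonempty
subsemigroup is a subgroup, so S = G means strong connectivity, while for S ≠ G the vertices in S
are cut off from the rest.

Necessity of the two conditions rests on one family of representations, on functions on infinite
paths, in which edges act by shifts. Idempotent weights, constant along edges, may be inserted: the
indicator of S kills some vertices but not all, so the kernel is a proper nonzero ideal
(`not_isSimpleRing_of_component`). Edges may also be twisted by a unit t. If N = 1, some closed path
of length n > 0 acts like its base vertex at t = 1; simplicity would make them equal, but at t = X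
they differ by the factor X ^ n (`not_isSimpleRing_of_bijective`).

Sufficiency rests on the reduction `hasVertexMultiple`: if N ≥ 2, every a ≠ 0 has a multiple x * a *
y that is a vertex. Edges on the right absorb the ghost edges, ghost edges on the left strip initial
edges until a vertex term appears, and the remaining closed paths are killed one by one through
exits. No normal form or linear independence is needed. Strong connectivity then puts all vertices,
hence their sum, which is the identity, into any nonzero ideal. A second edge at the vertex also
makes it an infinite idempotent, which is transported into any nonzero right ideal. -/

namespace LeavittPathAlgebra

variable {K : Type w} [Field K] {E : DirectedGraph.{u, v}}

/-! ### Generators and relations -/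

variable (K) in
/-- A vertex as an element of the Leavitt path algebra. -/
noncomputable def vert (x : E.Vert) : LeavittPathAlgebra K E := mk K E (FreeLeavitt.gen K (.vert x))

variable (K) in
/-- An edge as an element of the Leavitt path algebra. -/
noncomputable def edge (e : E.Edge) : LeavittPathAlgebra K E := mk K E (FreeLeavitt.gen K (.edge e))

variable (K) in
/-- A ghost edge as an element of the Leavitt path algebra. -/
noncomputable def ghost (e : E.Edge) : LeavittPathAlgebra K E :=
  mk K E (FreeLeavitt.gen K (.ghost e))

theorem mk_eq_of_rel {a b : FreeLeavitt K E} (h : LeavittRel K E a b) : mk K E a = mk K E b :=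
  mk_eq_mk.2 (RingConGen.Rel.of _ _ ⟨1, a, b, h, (one_smul _ _).symm, (one_smul _ _).symm⟩)

@[simp] theorem vert_mul_self (x : E.Vert) : vert K x * vert K x = vert K x := by
  simpa only [vert, edge, ghost, map_mul] using mk_eq_of_rel (LeavittRel.vert_mul_self (K := K) x)

theorem vert_mul_vert {x y : E.Vert} (h : x ≠ y) : vert K x * vert K y = 0 := by
  simpa only [vert, edge, ghost, map_mul, map_zero] using
    mk_eq_of_rel (LeavittRel.vert_mul_vert (K := K) x y h)

@[simp] theorem src_mul_edge (e : E.Edge) : vert K (E.src e) * edge K e = edge K e := by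
  simpa only [vert, edge, ghost, map_mul] using mk_eq_of_rel (LeavittRel.src_mul_edge (K := K) e)

@[simp] theorem edge_mul_rng (e : E.Edge) : edge K e * vert K (E.rng e) = edge K e := by
  simpa only [vert, edge, ghost, map_mul] using mk_eq_of_rel (LeavittRel.edge_mul_rng (K := K) e)

@[simp] theorem rng_mul_ghost (e : E.Edge) : vert K (E.rng e) * ghost K e = ghost K e := by
  simpa only [vert, edge, ghost, map_mul] using mk_eq_of_rel (LeavittRel.rng_mul_ghost (K := K) e)

@[simp] theorem ghost_mul_src (e : E.Edge) : ghost K e * vert K (E.src e) = ghost K e := by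
  simpa only [vert, edge, ghost, map_mul] using mk_eq_of_rel (LeavittRel.ghost_mul_src (K := K) e)

@[simp] theorem ghost_mul_edge_self (e : E.Edge) :
    ghost K e * edge K e = vert K (E.rng e) := by
  simpa only [vert, edge, ghost, map_mul] using
    mk_eq_of_rel (LeavittRel.ghost_mul_edge_self (K := K) e)

theorem ghost_mul_edge {e f : E.Edge} (h : e ≠ f) : ghost K e * edge K f = 0 := by
  simpa only [vert, edge, ghost, map_mul, map_zero] using
    mk_eq_of_rel (LeavittRel.ghost_mul_edge (K := K) e f h)

theorem vert_mul_edge {x : E.Vert} {e : E.Edge} (h : x ≠ E.src e) :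
    vert K x * edge K e = 0 := by
  rw [← src_mul_edge, ← mul_assoc, vert_mul_vert h, zero_mul]

open Classical in
theorem sum_edge_mul_ghost [Fintype E.Edge] (x : E.Vert) (hx : ∃ e, E.src e = x) :
    ∑ e with E.src e = x, edge K e * ghost K e = vert K x := by
  have h := mk_eq_of_rel (LeavittRel.sum_edge_mul_ghost (K := K) x (Set.toFinite _) hx)
  rw [map_sum] at h
  simp only [map_mul] at h
  rw [vert, h]
  exact Finset.sum_congr (by ext; simp) fun _ _ => rfl

/-- Every element is a linear combination of products of generators. -/
theorem induction_on {P : LeavittPathAlgebra K E → Prop} (a : LeavittPathAlgebra K E)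
    (zero : P 0) (add : ∀ a b, P a → P b → P (a + b)) (smul : ∀ (c : K) a, P a → P (c • a))
    (vert_ : ∀ x, P (vert K x)) (edge_ : ∀ e, P (edge K e)) (ghost_ : ∀ e, P (ghost K e))
    (vert_mul : ∀ x a, P a → P (vert K x * a)) (edge_mul : ∀ e a, P a → P (edge K e * a))
    (ghost_mul : ∀ e a, P a → P (ghost K e * a)) : P a := by
  obtain ⟨a, rfl⟩ := mk_surjective K E a
  have hword : ∀ m : FreeSemigroup (LeavittGen E), P (mk K E (MonoidAlgebra.single m 1)) := by
    intro m
    induction m using FreeSemigroup.recOnMul with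
    | ih1 x =>
      cases x with
      | vert x => exact vert_ x
      | edge e => exact edge_ e
      | ghost e => exact ghost_ e
    | ih2 x y _ hy =>
      have : MonoidAlgebra.single (FreeSemigroup.of x * y) (1 : K) =
          FreeLeavitt.gen K x * MonoidAlgebra.single y 1 := by
        rw [FreeLeavitt.gen, MonoidAlgebra.single_mul_single, one_mul]
      rw [this, map_mul]
      cases x with
      | vert x => exact vert_mul x _ hy
      | edge e => exact edge_mul e _ hy
      | ghost e => exact ghost_mul e _ hy
  induction a using MonoidAlgebra.induction_linear with
  | zero => simpa using zero
  | add a b ha hb => simpa using add _ _ ha hb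
  | single m c =>
    have : MonoidAlgebra.single m c = c • (MonoidAlgebra.single m 1 : FreeLeavitt K E) := by
      simp
    rw [this, mk_smul]
    exact smul c _ (hword m)

section Lift

variable {R : Type*} [Ring R] [Algebra K R]

/-- The homomorphism of the free algebra given by the images of the generators. -/
noncomputable def freeLift (φ : LeavittGen E → R) : FreeLeavitt K E →ₙₐ[K] R :=
  MonoidAlgebra.liftMagma K (FreeSemigroup.lift φ)

@[simp] theorem freeLift_gen (φ : LeavittGen E → R) (x : LeavittGen E) :
    freeLift φ (FreeLeavitt.gen K x) = φ x := by
  simp [freeLift, FreeLeavitt.gen, MonoidAlgebra.liftMagma]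

/-- The universal property of the Leavitt path algebra. -/
noncomputable def lift (φ : LeavittGen E → R)
    (hφ : ∀ a b, LeavittRel K E a b → freeLift φ a = freeLift φ b) :
    LeavittPathAlgebra K E →ₙ+* R :=
  have h : ∀ a b, leavittCon K E a b → freeLift φ a = freeLift φ b := by
    intro a b hab
    have h' : RingConGen.Rel _ a b := hab
    induction h' with
    | of x y hxy =>
      obtain ⟨d, x', y', hr, rfl, rfl⟩ := hxy
      rw [map_smul, map_smul, hφ _ _ hr]
    | refl x => rfl
    | symm h₁ ih => exact (ih h₁).symm
    | trans h₁ h₂ ih₁ ih₂ => exact (ih₁ h₁).trans (ih₂ h₂)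
    | add h₁ h₂ ih₁ ih₂ => rw [map_add, map_add, ih₁ h₁, ih₂ h₂]
    | mul h₁ h₂ ih₁ ih₂ => rw [map_mul, map_mul, ih₁ h₁, ih₂ h₂]
  { toFun := Quotient.lift (freeLift φ) h
    map_zero' := map_zero (freeLift (K := K) φ)
    map_add' := by
      intro a b
      obtain ⟨a, rfl⟩ := mk_surjective K E a
      obtain ⟨b, rfl⟩ := mk_surjective K E b
      exact map_add (freeLift (K := K) φ) a b
    map_mul' := by
      intro a b
      obtain ⟨a, rfl⟩ := mk_surjective K E a
      obtain ⟨b, rfl⟩ := mk_surjective K E b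
      exact map_mul (freeLift (K := K) φ) a b }

theorem lift_mk (φ : LeavittGen E → R)
    (hφ : ∀ a b, LeavittRel K E a b → freeLift φ a = freeLift φ b) (a : FreeLeavitt K E) :
    lift φ hφ (mk K E a) = freeLift φ a := rfl

end Lift

end LeavittPathAlgebra

/-! ### Infinite paths and the representation on functions on them -/

namespace DirectedGraph

variable {E : DirectedGraph.{u, v}}

variable (E) in
/-- The infinite paths in a directed graph. -/
def InfPath : Type v := {x : ℕ → E.Edge // ∀ n, E.rng (x n) = E.src (x (n + 1))}

namespace InfPath

/-- The first edge of an infinite path. -/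
def head (x : E.InfPath) : E.Edge := x.1 0

/-- The infinite path without its first edge. -/
def tail (x : E.InfPath) : E.InfPath := ⟨fun n => x.1 (n + 1), fun n => x.2 (n + 1)⟩

/-- The infinite path with an edge added in front. -/
def cons (e : E.Edge) (x : E.InfPath) (h : E.rng e = E.src x.head) : E.InfPath :=
  ⟨fun n => Nat.casesOn n e x.1, fun n => by
    cases n with
    | zero => exact h
    | succ n => exact x.2 n⟩

@[simp] theorem head_cons (e : E.Edge) (x : E.InfPath) (h : E.rng e = E.src x.head) :
    (cons e x h).head = e := rfl

@[simp] theorem tail_cons (e : E.Edge) (x : E.InfPath) (h : E.rng e = E.src x.head) :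
    (cons e x h).tail = x := rfl

theorem rng_head (x : E.InfPath) : E.rng x.head = E.src x.tail.head := x.2 0

@[simp] theorem cons_head_tail (x : E.InfPath) : cons x.head x.tail x.rng_head = x := by
  apply Subtype.ext
  funext n
  cases n <;> rfl

theorem head_iterate_tail (x : E.InfPath) (n : ℕ) : (tail^[n] x).head = x.1 n := by
  induction n generalizing x with
  | zero => rfl
  | succ n ih => rw [Function.iterate_succ_apply, ih]; rfl

/-- If every vertex emits an edge, then every vertex is the source of an infinite path. -/
theorem exists_src_head_eq (h : ∀ x, ∃ e, E.src e = x) (x : E.Vert) :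
    ∃ p : E.InfPath, E.src p.head = x := by
  choose next hnext using h
  refine ⟨⟨fun n => next ((E.rng ∘ next)^[n] x), fun n => ?_⟩, hnext x⟩
  rw [hnext, Function.iterate_succ_apply', Function.comp_apply]

/-- If no two edges have the same source, then an infinite path is determined by its source. -/
theorem eq_of_src_head_eq (h : Function.Injective E.src) {x y : E.InfPath}
    (hxy : E.src x.head = E.src y.head) : x = y := by
  apply Subtype.ext
  funext n
  induction n with
  | zero => exact h hxy
  | succ n ih => exact h (by rw [← x.2, ← y.2, ih])

end InfPath

end DirectedGraph

namespace LeavittPathAlgebra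

open DirectedGraph

variable {K : Type w} [Field K] {E : DirectedGraph.{u, v}}
variable {A : Type*} [CommRing A] [Algebra K A]

open Classical in
/-- The action of the generators of the Leavitt path algebra on the functions on the infinite
paths. An edge acts by a shift, twisted by a unit `t` and restricted by a weight `c`. -/
noncomputable def infPathFun (K : Type w) [Field K] [Algebra K A] (c : E.Vert → A) (t : Aˣ) :
    LeavittGen E → Module.End K (E.InfPath → A)
  | .vert x =>
    { toFun := fun f p => if E.src p.head = x then c x * f p else 0
      map_add' := fun f g => by ext p; simp only [Pi.add_apply]; split_ifs <;> ring
      map_smul' := fun a f => by ext p; simp }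
  | .edge e =>
    { toFun := fun f p => if p.head = e then c (E.src e) * t * f p.tail else 0
      map_add' := fun f g => by ext p; simp only [Pi.add_apply]; split_ifs <;> ring
      map_smul' := fun a f => by ext p; simp }
  | .ghost e =>
    { toFun := fun f p => if h : E.rng e = E.src p.head then
        c (E.src e) * ↑t⁻¹ * f (p.cons e h) else 0
      map_add' := fun f g => by ext p; simp only [Pi.add_apply]; split_ifs <;> ring
      map_smul' := fun a f => by ext p; simp }

variable {c : E.Vert → A} {t : Aˣ}

open Classical in
theorem infPathFun_vert (x : E.Vert) (f : E.InfPath → A) (p : E.InfPath) :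
    infPathFun K c t (.vert x) f p = if E.src p.head = x then c x * f p else 0 := rfl

open Classical in
theorem infPathFun_edge (e : E.Edge) (f : E.InfPath → A) (p : E.InfPath) :
    infPathFun K c t (.edge e) f p = if p.head = e then c (E.src e) * t * f p.tail else 0 := rfl

open Classical in
theorem infPathFun_ghost (e : E.Edge) (f : E.InfPath → A) (p : E.InfPath) :
    infPathFun K c t (.ghost e) f p =
      if h : E.rng e = E.src p.head then c (E.src e) * ↑t⁻¹ * f (p.cons e h) else 0 := rfl

/-- An infinite path is uniquely its head followed by its tail, which gives the relations for the
plain shifts. The weights are idempotent and agree at both ends of an edge, so they merge, and t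
cancels against its inverse. -/
theorem freeLift_infPathFun_eq (hc : ∀ x, IsIdempotentElem (c x))
    (hE : ∀ e, c (E.src e) = c (E.rng e)) (a b : FreeLeavitt K E) (h : LeavittRel K E a b) :
    freeLift (infPathFun K c t) a = freeLift (infPathFun K c t) b := by
  have hcc : ∀ x y, c x * (c x * y) = c x * y := fun x y => by rw [← mul_assoc, hc x]
  cases h with
  | vert_mul_self x =>
    ext f p
    by_cases h : E.src p.head = x <;> simp [infPathFun_vert, h, hcc]
  | vert_mul_vert x y hxy =>
    ext f p
    by_cases h : E.src p.head = x <;> simp [infPathFun_vert, h, hxy]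
  | src_mul_edge e =>
    ext f p
    by_cases h : p.head = e <;> simp [infPathFun_vert, infPathFun_edge, h, mul_assoc, hcc]
  | edge_mul_rng e =>
    ext f p
    by_cases h : p.head = e
    · subst h
      simp only [Module.End.mul_apply, infPathFun_vert, infPathFun_edge, if_true, freeLift_gen,
        map_mul, ← p.rng_head, ← hE]
      rw [mul_assoc, mul_left_comm, hcc, mul_left_comm, mul_assoc]
    · simp [infPathFun_edge, h]
  | rng_mul_ghost e =>
    ext f p
    by_cases h : E.rng e = E.src p.head
    · simp [infPathFun_vert, infPathFun_ghost, h, mul_assoc, hcc, hE]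
    · simp [infPathFun_vert, infPathFun_ghost, h, Ne.symm h]
  | ghost_mul_src e =>
    ext f p
    by_cases h : E.rng e = E.src p.head <;>
      simp [infPathFun_vert, infPathFun_ghost, h, mul_assoc, hcc, mul_left_comm _ (c _)]
  | ghost_mul_edge_self e =>
    ext f p
    by_cases h : E.rng e = E.src p.head
    · simp [infPathFun_vert, infPathFun_edge, infPathFun_ghost, h, mul_assoc, hcc, hE,
        mul_left_comm _ (c _)]
    · simp [infPathFun_vert, infPathFun_ghost, h, Ne.symm h]
  | ghost_mul_edge e e' hne =>
    ext f p
    simp [infPathFun_edge, infPathFun_ghost, hne]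
  | sum_edge_mul_ghost x hfin hne =>
    classical
    ext f p
    -- At a given p only the summand of the edge `p.head` survives.
    have h1 : ∀ e, infPathFun K c t (.edge e) (infPathFun K c t (.ghost e) f) p =
        if p.head = e then c (E.src p.head) * f p else 0 := by
      intro e
      by_cases h : p.head = e
      · subst h
        simp [infPathFun_edge, infPathFun_ghost, p.rng_head, mul_assoc, hcc,
          mul_left_comm _ (c _)]
      · simp [infPathFun_edge, h]
    by_cases h : E.src p.head = x
    · simp [infPathFun_vert, h1, h]
    · simp [infPathFun_vert, h1, h]

/-- The representation of the Leavitt path algebra on the functions on the infinite paths. -/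
noncomputable def infPathRep (K : Type w) [Field K] [Algebra K A] (c : E.Vert → A) (t : Aˣ)
    (hc : ∀ x, IsIdempotentElem (c x)) (hE : ∀ e, c (E.src e) = c (E.rng e)) :
    LeavittPathAlgebra K E →ₙ+* Module.End K (E.InfPath → A) :=
  lift (infPathFun K c t) (freeLift_infPathFun_eq hc hE)

section

variable {hc : ∀ x, IsIdempotentElem (c x)} {hE : ∀ e, c (E.src e) = c (E.rng e)}

open Classical in
theorem infPathRep_vert (x : E.Vert) (f : E.InfPath → A) (p : E.InfPath) :
    infPathRep K c t hc hE (vert K x) f p = if E.src p.head = x then c x * f p else 0 := by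
  rw [infPathRep, vert, lift_mk, freeLift_gen, infPathFun_vert]

open Classical in
theorem infPathRep_edge (e : E.Edge) (f : E.InfPath → A) (p : E.InfPath) :
    infPathRep K c t hc hE (edge K e) f p =
      if p.head = e then c (E.src e) * t * f p.tail else 0 := by
  rw [infPathRep, edge, lift_mk, freeLift_gen, infPathFun_edge]

end

/-- In the untwisted representation x acts as the indicator of the infinite paths starting at x, and
without sinks there is such a path. -/
theorem vert_ne_zero (h : ∀ x, ∃ e, E.src e = x) (x : E.Vert) : vert K x ≠ 0 := by
  intro h0
  obtain ⟨p, hp⟩ := InfPath.exists_src_head_eq h x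
  have := infPathRep_vert (K := K) (c := fun _ => (1 : K)) (t := 1)
    (hc := fun _ => IsIdempotentElem.one) (hE := fun _ => rfl) x 1 p
  rw [h0, map_zero] at this
  simp [hp] at this

/-! ### Obstructions to simplicity: a separated set of vertices, or out-degree one -/

/-- A homomorphism from a simple ring that is not zero is injective. -/
theorem injective_of_isSimpleRing {R S : Type*} [NonUnitalRing R] [NonUnitalRing S]
    [IsSimpleRing R] (f : R →ₙ+* S) {a : R} (ha : f a ≠ 0) : Function.Injective f := by
  rcases eq_bot_or_eq_top (TwoSidedIdeal.ker f) with h | h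
  · exact (TwoSidedIdeal.ker_eq_bot f).1 h
  · exact absurd (by rw [← TwoSidedIdeal.mem_ker, h]; trivial) ha

/-- The Leavitt path algebra of a graph in which a proper nonempty set of vertices is a union of
connected components is not simple. -/
theorem not_isSimpleRing_of_component (h : ∀ x, ∃ e, E.src e = x) (H : Set E.Vert)
    (hne : H.Nonempty) (huniv : H ≠ Set.univ) (hH : ∀ e, E.src e ∈ H ↔ E.rng e ∈ H) :
    ¬ IsSimpleRing (LeavittPathAlgebra K E) := by
  classical
  intro hs
  obtain ⟨x, hx⟩ := hne
  obtain ⟨y, hy⟩ := (Set.ne_univ_iff_exists_notMem H).1 huniv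
  let c : E.Vert → K := fun z => if z ∈ H then 1 else 0
  let φ := infPathRep K c 1 (fun z => by by_cases hz : z ∈ H <;> simp [c, hz, IsIdempotentElem])
    (fun e => by simp only [c, hH])
  have hφx : φ (vert K x) ≠ 0 := by
    intro h0
    obtain ⟨p, hp⟩ := InfPath.exists_src_head_eq h x
    have := congr_fun (congr_arg (fun g => g 1) h0) p
    simp [φ, infPathRep_vert, hp, c, hx] at this
  have hφy : φ (vert K y) = 0 := by
    ext f p
    simp [φ, infPathRep_vert, c, hy]
  exact vert_ne_zero h y (injective_of_isSimpleRing φ hφx (by rw [hφy, map_zero]))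

variable (K) in
/-- The initial segment of length `n` of an infinite path. -/
noncomputable def initial : ℕ → E.InfPath → LeavittPathAlgebra K E
  | 0, p => vert K (E.src p.head)
  | n + 1, p => edge K p.head * initial n p.tail

theorem vert_mul_initial (n : ℕ) (p : E.InfPath) :
    vert K (E.src p.head) * initial K n p = initial K n p := by
  cases n with
  | zero => simp [initial]
  | succ n => rw [initial, ← mul_assoc, src_mul_edge]

/-- The power of t records the length, which is what tells a closed path from a vertex. -/
theorem infPathRep_initial (t : Aˣ) (n : ℕ) (f : E.InfPath → A) (p : E.InfPath) :
    infPathRep K (fun _ => 1) t (fun _ => IsIdempotentElem.one) (fun _ => rfl) (initial K n p) f p =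
      t ^ n * f (InfPath.tail^[n] p) := by
  induction n generalizing p with
  | zero => simp [initial, infPathRep_vert]
  | succ n ih =>
    rw [initial, map_mul, Module.End.mul_apply, infPathRep_edge, if_pos rfl, ih,
      Function.iterate_succ_apply, pow_succ']
    ring

/-- The Leavitt path algebra of a finite graph in which every vertex emits exactly one edge is not
simple. -/
theorem not_isSimpleRing_of_bijective [Finite E.Vert] [Nonempty E.Vert]
    (h : Function.Bijective E.src) : ¬ IsSimpleRing (LeavittPathAlgebra K E) := by
  intro hs
  obtain ⟨p, n, hn, hp⟩ : ∃ (p : E.InfPath) (n : ℕ), n ≠ 0 ∧ InfPath.tail^[n] p = p := by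
    obtain ⟨q, -⟩ := InfPath.exists_src_head_eq h.2 (Classical.arbitrary E.Vert)
    -- Some vertex is visited twice; as a path is determined by its source, the tail from there is
    -- periodic.
    obtain ⟨i, j, hij, hq⟩ := Finite.exists_ne_map_eq_of_infinite fun i => E.src (q.1 i)
    wlog hlt : i < j generalizing i j
    · exact this j i hij.symm hq.symm (by omega)
    refine ⟨InfPath.tail^[i] q, j - i, by omega, ?_⟩
    rw [← Function.iterate_add_apply, Nat.sub_add_cancel hlt.le]
    refine InfPath.eq_of_src_head_eq h.1 ?_
    rw [InfPath.head_iterate_tail, InfPath.head_iterate_tail, hq]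
  let φ := fun t : (RatFunc K)ˣ =>
    infPathRep K (E := E) (fun _ => 1) t (fun _ => IsIdempotentElem.one)
    (fun _ => rfl)
  have hv : φ 1 (vert K (E.src p.head)) ≠ 0 := by
    intro h0
    have := congr_fun (congr_arg (fun g => g 1) h0) p
    simp [φ, infPathRep_vert] at this
  -- At t = 1 the two actions agree: p is the only infinite path from its source, and n shifts fix
  -- it.
  have heq : vert K (E.src p.head) = initial K n p := by
    refine injective_of_isSimpleRing (φ 1) hv ?_
    ext1 f
    funext q
    by_cases hq : E.src q.head = E.src p.head
    · rw [InfPath.eq_of_src_head_eq h.1 hq, infPathRep_initial, hp]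
      simp [φ, infPathRep_vert]
    · rw [← vert_mul_initial, map_mul, Module.End.mul_apply]
      simp [φ, infPathRep_vert, hq]
  -- At t = X the same equality reads 1 = X ^ n.
  let t : (RatFunc K)ˣ := Units.mk0 RatFunc.X RatFunc.X_ne_zero
  have h1 := congr_fun (congr_arg (fun a => φ t a 1) heq) p
  simp only [φ, infPathRep_initial, infPathRep_vert] at h1
  have h2 : algebraMap (Polynomial K) (RatFunc K) (Polynomial.X ^ n) =
      algebraMap (Polynomial K) (RatFunc K) 1 := by
    simpa [t] using h1.symm
  have h3 := RatFunc.algebraMap_injective K h2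
  have h4 := congr_arg Polynomial.natDegree h3
  simp at h4
  exact hn h4

end LeavittPathAlgebra

namespace LeavittPathAlgebra

variable {K : Type w} [Field K] {E : DirectedGraph.{u, v}}

/-! ### Reduction of nonzero elements to vertices -/

/-- The ideal generated by `a` contains a vertex, in the strong sense that a single two-sided
multiple of `a` is a vertex. -/
def HasVertexMultiple (a : LeavittPathAlgebra K E) : Prop :=
  ∃ x y v, x * a * y = vert K v

theorem HasVertexMultiple.of_mul_left {a b : LeavittPathAlgebra K E}
    (h : HasVertexMultiple (b * a)) : HasVertexMultiple a := by
  obtain ⟨x, y, v, h⟩ := h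
  exact ⟨x * b, y, v, by rw [← h]; simp only [mul_assoc]⟩

theorem HasVertexMultiple.of_mul_right {a b : LeavittPathAlgebra K E}
    (h : HasVertexMultiple (a * b)) : HasVertexMultiple a := by
  obtain ⟨x, y, v, h⟩ := h
  exact ⟨x, b * y, v, by rw [← h]; simp only [mul_assoc]⟩

variable (K) in
/-- The path with edges `l` and range `x`; it is zero if these do not form a path. -/
noncomputable def path (l : List E.Edge) (x : E.Vert) : LeavittPathAlgebra K E :=
  l.foldr (fun e a => edge K e * a) (vert K x)

@[simp] theorem path_nil (x : E.Vert) : path K [] x = vert K x := rfl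

@[simp] theorem path_cons (e : E.Edge) (l : List E.Edge) (x : E.Vert) :
    path K (e :: l) x = edge K e * path K l x := rfl

theorem path_mul_edge (l : List E.Edge) (e : E.Edge) :
    path K l (E.src e) * edge K e = path K (l ++ [e]) (E.rng e) := by
  induction l with
  | nil => simp
  | cons f l ih => rw [path_cons, mul_assoc, ih, List.cons_append, path_cons]

variable (K) in
/-- `PathSum n x a` says that `a` is a linear combination of `n` paths of positive length with range
`x`. -/
inductive PathSum : ℕ → E.Vert → LeavittPathAlgebra K E → Prop
  | zero (x : E.Vert) : PathSum 0 x 0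
  | add {n : ℕ} {x : E.Vert} {a : LeavittPathAlgebra K E} (c : K) (e : E.Edge) (l : List E.Edge)
      (h : PathSum n x a) : PathSum (n + 1) x (c • path K (e :: l) x + a)

/-- Each term loses its first edge and gains f at the end, so its length stays positive. A term that
dies is kept with coefficient 0, so n does not change. -/
theorem PathSum.ghost_mul_mul_edge {n : ℕ} {x : E.Vert} {a : LeavittPathAlgebra K E}
    (h : PathSum K n x a) {f : E.Edge} (hf : E.src f = x) :
    PathSum K n (E.rng f) (ghost K f * a * edge K f) := by
  subst hf
  generalize hx : E.src f = x at h
  induction h with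
  | zero => simpa using PathSum.zero (K := K) (E.rng f)
  | add c e l h ih =>
    subst hx
    have key : ∃ (c' : K) (e' : E.Edge) (l' : List E.Edge),
        ghost K f * (c • path K (e :: l) (E.src f)) * edge K f =
          c' • path K (e' :: l') (E.rng f) := by
      rw [mul_smul_comm, smul_mul_assoc, mul_assoc, path_mul_edge, List.cons_append, path_cons,
        ← mul_assoc]
      by_cases hfe : f = e
      · subst hfe
        rw [ghost_mul_edge_self]
        obtain ⟨g, m, hm⟩ : ∃ g m, l ++ [f] = g :: m := by
          cases l with
          | nil => exact ⟨_, _, rfl⟩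
          | cons g l => exact ⟨_, _, rfl⟩
        rw [hm, path_cons, ← mul_assoc]
        by_cases hg : E.rng f = E.src g
        · exact ⟨c, g, m, by rw [hg, src_mul_edge, path_cons]⟩
        · exact ⟨0, f, [], by rw [vert_mul_edge hg, zero_mul, smul_zero, zero_smul]⟩
      · exact ⟨0, f, [], by rw [ghost_mul_edge hfe, zero_mul, smul_zero, zero_smul]⟩
    obtain ⟨c', e', l', h'⟩ := key
    rw [mul_add, add_mul, h']
    exact (ih rfl).add c' e' l'

/-- If every vertex emits at least two edges, then a linear combination of a vertex `x` and finitely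
many closed paths at `x` can be cut down to a vertex. -/
theorem PathSum.hasVertexMultiple (h2 : ∀ (x : E.Vert) (e : E.Edge), ∃ f, E.src f = x ∧ f ≠ e)
    {n : ℕ} {x : E.Vert} {a : LeavittPathAlgebra K E} (h : PathSum K n x a) {k : K} (hk : k ≠ 0) :
    HasVertexMultiple (k • vert K x + a) := by
  induction n generalizing x a with
  | zero =>
    cases h
    exact ⟨k⁻¹ • vert K x, vert K x, x, by simp [mul_smul_comm, smul_mul_assoc, smul_smul, hk]⟩
  | succ n ih =>
    cases h with
    | @add _ _ b c e l h =>
      -- Conjugation by an exit f ≠ e kills the term beginning with e and turns the vertex term into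
      -- k times the range of f, leaving one term fewer.
      obtain ⟨f, rfl, hfe⟩ := h2 x e
      have := ih (h.ghost_mul_mul_edge rfl)
      have heq : ghost K f * (k • vert K (E.src f) + (c • path K (e :: l) (E.src f) + b)) *
          edge K f = k • vert K (E.rng f) + ghost K f * b * edge K f := by
        have h0 : ghost K f * path K (e :: l) (E.src f) = 0 := by
          rw [path_cons, ← mul_assoc, ghost_mul_edge hfe, zero_mul]
        simp only [mul_add, add_mul, mul_smul_comm, smul_mul_assoc, h0, smul_zero,
          zero_add, ghost_mul_src, ghost_mul_edge_self]
      rw [← heq] at this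
      exact this.of_mul_right.of_mul_left

variable (K) in
/-- `IsPathSum x a` says that `a` is a linear combination of paths with range `x`, all of positive
length. -/
def IsPathSum (x : E.Vert) (a : LeavittPathAlgebra K E) : Prop := ∃ n, PathSum K n x a

theorem IsPathSum.zero (x : E.Vert) : IsPathSum K x 0 := ⟨0, .zero x⟩

theorem IsPathSum.add {x : E.Vert} {a b : LeavittPathAlgebra K E} (ha : IsPathSum K x a)
    (hb : IsPathSum K x b) : IsPathSum K x (a + b) := by
  obtain ⟨n, ha⟩ := ha
  induction ha with
  | zero => simpa using hb
  | add c e l h ih =>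
    obtain ⟨m, hm⟩ := ih hb
    exact ⟨m + 1, by rw [add_assoc]; exact hm.add c e l⟩

theorem IsPathSum.sum {ι : Type*} (s : Finset ι) {x : E.Vert} {a : ι → LeavittPathAlgebra K E}
    (h : ∀ i ∈ s, IsPathSum K x (a i)) : IsPathSum K x (∑ i ∈ s, a i) :=
  Finset.sum_induction _ _ (fun _ _ => IsPathSum.add) (.zero x) h

theorem IsPathSum.edge_mul {x : E.Vert} {a : LeavittPathAlgebra K E} (h : IsPathSum K x a)
    (e : E.Edge) : IsPathSum K x (edge K e * a) := by
  obtain ⟨n, h⟩ := h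
  refine ⟨n, ?_⟩
  induction h with
  | zero => simpa using PathSum.zero (K := K) _
  | add c f l h ih =>
    rw [mul_add, mul_smul_comm, ← path_cons]
    exact ih.add c e (f :: l)

section Finite

theorem ghost_mul_sum_edge_mul [Fintype E.Edge] (e : E.Edge) (b : E.Edge → LeavittPathAlgebra K E) :
    ghost K e * ∑ f, edge K f * b f = vert K (E.rng e) * b e := by
  rw [Finset.mul_sum, Finset.sum_eq_single e]
  · rw [← mul_assoc, ghost_mul_edge_self]
  · intro f _ hf
    rw [← mul_assoc, ghost_mul_edge hf.symm, zero_mul]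
  · simp

variable [Fintype E.Vert]

theorem vert_mul_sum (k : E.Vert → K) (x : E.Vert) :
    vert K x * ∑ y, k y • vert K y = k x • vert K x := by
  rw [Finset.mul_sum, Finset.sum_eq_single x]
  · rw [mul_smul_comm, vert_mul_self]
  · intro y _ hy
    rw [mul_smul_comm, vert_mul_vert hy.symm, smul_zero]
  · simp

theorem sum_smul_vert_mul_edge (k : E.Vert → K) (e : E.Edge) :
    (∑ y, k y • vert K y) * edge K e = k (E.src e) • edge K e := by
  rw [← src_mul_edge, ← mul_assoc, Finset.sum_mul, Finset.sum_eq_single (E.src e)]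
  · rw [smul_mul_assoc, vert_mul_self, smul_mul_assoc]
  · intro y _ hy
    rw [smul_mul_assoc, vert_mul_vert hy, smul_zero]
  · simp

theorem sum_vert_mul (a : LeavittPathAlgebra K E) : (∑ x, vert K x) * a = a := by
  have key : ∀ (y : E.Vert), (∑ x, vert K x) * vert K y = vert K y := fun y => by
    rw [Finset.sum_mul, Finset.sum_eq_single y]
    · exact vert_mul_self y
    · intro x _ hx
      exact vert_mul_vert hx
    · simp
  induction a using induction_on with
  | zero => simp
  | add a b ha hb => rw [mul_add, ha, hb]
  | smul c a ha => rw [mul_smul_comm, ha]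
  | vert_ x => exact key x
  | edge_ e => rw [← src_mul_edge, ← mul_assoc, key]
  | ghost_ e => rw [← rng_mul_ghost, ← mul_assoc, key]
  | vert_mul x a ha => rw [← mul_assoc, key]
  | edge_mul e a ha => rw [← src_mul_edge, mul_assoc, ← mul_assoc, key]
  | ghost_mul e a ha => rw [← rng_mul_ghost, mul_assoc, ← mul_assoc, key]

theorem mul_sum_vert (a : LeavittPathAlgebra K E) : a * ∑ x, vert K x = a := by
  have key : ∀ (y : E.Vert), vert K y * ∑ x, vert K x = vert K y := fun y => by
    simpa using vert_mul_sum (fun _ => (1 : K)) y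
  induction a using induction_on with
  | zero => simp
  | add a b ha hb => rw [add_mul, ha, hb]
  | smul c a ha => rw [smul_mul_assoc, ha]
  | vert_ x => exact key x
  | edge_ e => rw [← edge_mul_rng, mul_assoc, key]
  | ghost_ e => rw [← ghost_mul_src, mul_assoc, key]
  | vert_mul x a ha => rw [mul_assoc, ha]
  | edge_mul e a ha => rw [mul_assoc, ha]
  | ghost_mul e a ha => rw [mul_assoc, ha]

/-! ### Elements without ghost edges -/

variable [Fintype E.Edge]

/-- The linear combinations of paths, described recursively by their parts of length zero and the
parts that begin with a given edge. -/
inductive IsReal : LeavittPathAlgebra K E → Prop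
  | zero : IsReal 0
  | mk (k : E.Vert → K) (b : E.Edge → LeavittPathAlgebra K E) (h : ∀ e, IsReal (b e)) :
      IsReal (∑ x, k x • vert K x + ∑ e, edge K e * b e)

namespace IsReal

theorem add {a b : LeavittPathAlgebra K E} (ha : IsReal a) (hb : IsReal b) : IsReal (a + b) := by
  induction ha generalizing b with
  | zero => simpa using hb
  | mk k a' ha' ih =>
    cases hb with
    | zero => simpa using IsReal.mk k a' ha'
    | mk m b' hb' =>
      have := IsReal.mk (fun x => k x + m x) (fun e => a' e + b' e) fun e => ih e (hb' e)
      simp only [add_smul, mul_add, Finset.sum_add_distrib] at this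
      rwa [add_add_add_comm] at this

theorem smul {a : LeavittPathAlgebra K E} (c : K) (ha : IsReal a) : IsReal (c • a) := by
  induction ha with
  | zero => simpa using IsReal.zero
  | mk k a' ha' ih =>
    simpa only [smul_add, Finset.smul_sum, smul_smul, mul_smul_comm] using
      IsReal.mk (fun x => c * k x) (fun e => c • a' e) ih

open Classical in
theorem smul_vert (c : K) (x : E.Vert) : IsReal (c • vert K x) := by
  have := IsReal.mk (fun y => if y = x then c else 0) (fun _ : E.Edge => 0) fun _ => .zero
  simpa [ite_smul] using this

theorem vert (x : E.Vert) : IsReal (vert K x) := by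
  simpa using smul_vert (1 : K) x

open Classical in
theorem edge_mul {a : LeavittPathAlgebra K E} (ha : IsReal a) (e : E.Edge) :
    IsReal (edge K e * a) := by
  have := IsReal.mk (fun _ => (0 : K)) (fun f => if f = e then a else 0)
    fun f => by split_ifs <;> [exact ha; exact .zero]
  simpa [mul_ite] using this

theorem edge (e : E.Edge) : IsReal (edge K e) := by
  simpa using (IsReal.vert (K := K) (E.rng e)).edge_mul e

theorem sum {ι : Type*} (s : Finset ι) {a : ι → LeavittPathAlgebra K E}
    (h : ∀ i ∈ s, IsReal (a i)) : IsReal (∑ i ∈ s, a i) :=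
  Finset.sum_induction _ _ (fun _ _ => add) .zero h

theorem vert_mul {a : LeavittPathAlgebra K E} (ha : IsReal a) (x : E.Vert) :
    IsReal (LeavittPathAlgebra.vert K x * a) := by
  cases ha with
  | zero => simpa using IsReal.zero
  | mk k a' ha' =>
    rw [mul_add, vert_mul_sum, Finset.mul_sum]
    refine (smul_vert _ x).add (sum _ fun e _ => ?_)
    by_cases hx : x = E.src e
    · rw [← mul_assoc, hx, src_mul_edge]
      exact (ha' e).edge_mul e
    · rw [← mul_assoc, vert_mul_edge hx, zero_mul]
      exact .zero

theorem mul_edge {a : LeavittPathAlgebra K E} (ha : IsReal a) (e : E.Edge) :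
    IsReal (a * LeavittPathAlgebra.edge K e) := by
  induction ha with
  | zero => simpa using IsReal.zero
  | mk k a' ha' ih =>
    rw [add_mul, sum_smul_vert_mul_edge, Finset.sum_mul]
    refine ((edge e).smul _).add (sum _ fun f _ => ?_)
    rw [mul_assoc]
    exact (ih f).edge_mul f

/-- The ghost edge cancels against the first edge of every path of positive length; what it leaves
of the vertex terms is cancelled by f. -/
theorem ghost_mul_mul_edge {a : LeavittPathAlgebra K E} (ha : IsReal a) (e f : E.Edge) :
    IsReal (ghost K e * a * LeavittPathAlgebra.edge K f) := by
  cases ha with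
  | zero => simpa using IsReal.zero
  | mk k a' ha' =>
    rw [mul_add, add_mul, ghost_mul_sum_edge_mul, mul_assoc, sum_smul_vert_mul_edge,
      mul_smul_comm]
    refine .add (.smul _ ?_) (((ha' e).vert_mul _).mul_edge f)
    by_cases hef : e = f
    · rw [hef, ghost_mul_edge_self]
      exact .vert _
    · rw [ghost_mul_edge hef]
      exact .zero

/-- This passes from the recursive description to a counted list of terms; the leading edge ensures
positive length. -/
theorem isPathSum_edge_mul_mul_vert {a : LeavittPathAlgebra K E} (ha : IsReal a) (e : E.Edge)
    (x : E.Vert) :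
    IsPathSum K x (LeavittPathAlgebra.edge K e * a * LeavittPathAlgebra.vert K x) := by
  induction ha generalizing e with
  | zero => simpa using IsPathSum.zero x
  | mk k a' ha' ih =>
    rw [mul_add, add_mul]
    refine .add ?_ ?_
    · have h : (∑ y, k y • LeavittPathAlgebra.vert K y) * LeavittPathAlgebra.vert K x =
          k x • LeavittPathAlgebra.vert K x := by
        rw [Finset.sum_mul, Finset.sum_eq_single x]
        · rw [smul_mul_assoc, vert_mul_self]
        · intro y _ hy
          rw [smul_mul_assoc, vert_mul_vert hy, smul_zero]
        · simp
      rw [mul_assoc, h, mul_smul_comm]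
      have := (PathSum.zero (K := K) x).add (k x) e []
      exact ⟨1, by simpa using this⟩
    · rw [Finset.mul_sum, Finset.sum_mul]
      refine .sum _ fun f _ => ?_
      rw [mul_assoc]
      exact (ih f f).edge_mul e

/-- If every vertex emits at least two edges, then every nonzero combination of paths can be cut
down to a vertex. -/
theorem hasVertexMultiple (h2 : ∀ (x : E.Vert) (e : E.Edge), ∃ f, E.src f = x ∧ f ≠ e)
    {a : LeavittPathAlgebra K E} (ha : IsReal a) (u : E.Vert)
    (hne : LeavittPathAlgebra.vert K u * a ≠ 0) :
    HasVertexMultiple (LeavittPathAlgebra.vert K u * a) := by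
  induction ha generalizing u with
  | zero => simp at hne
  | mk k b hb ih =>
    rw [mul_add, vert_mul_sum, Finset.mul_sum] at hne ⊢
    -- Without a term at u, some initial edge e can be stripped and the induction applies to its
    -- cofactor. Otherwise multiplying by u on the right leaves u and closed paths at u.
    by_cases hk : k u = 0
    · rw [hk, zero_smul, zero_add] at hne ⊢
      obtain ⟨e, -, he⟩ := Finset.exists_ne_zero_of_sum_ne_zero hne
      have hu : u = E.src e := by
        by_contra hu
        exact he (by rw [← mul_assoc, vert_mul_edge hu, zero_mul])
      subst hu
      have h0 : LeavittPathAlgebra.vert K (E.rng e) * b e ≠ 0 := by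
        intro h0
        rw [← edge_mul_rng, mul_assoc (LeavittPathAlgebra.edge K e), h0] at he
        simp at he
      have := ih e _ h0
      rw [← ghost_mul_sum_edge_mul, ← ghost_mul_src, mul_assoc, Finset.mul_sum] at this
      exact this.of_mul_left
    · refine .of_mul_right (b := LeavittPathAlgebra.vert K u) ?_
      rw [add_mul, smul_mul_assoc, vert_mul_self, Finset.sum_mul]
      obtain ⟨n, hn⟩ : IsPathSum K u (∑ e, LeavittPathAlgebra.vert K u *
          (LeavittPathAlgebra.edge K e * b e) * LeavittPathAlgebra.vert K u) := by
        refine .sum _ fun e _ => ?_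
        by_cases hu : u = E.src e
        · rw [← mul_assoc, hu, src_mul_edge]
          exact (hb e).isPathSum_edge_mul_mul_vert e _
        · rw [← mul_assoc, vert_mul_edge hu, zero_mul, zero_mul]
          exact .zero u
      exact hn.hasVertexMultiple h2 hk

end IsReal

/-! ### Absorbing ghost edges -/

/-- The elements that become linear combinations of paths after multiplication from the right by all
sufficiently long paths. -/
inductive IsEventuallyReal : LeavittPathAlgebra K E → Prop
  | of_isReal {a : LeavittPathAlgebra K E} (h : IsReal a) : IsEventuallyReal a
  | of_mul_edge {a : LeavittPathAlgebra K E} (h : ∀ e, IsEventuallyReal (a * edge K e)) :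
      IsEventuallyReal a

namespace IsEventuallyReal

theorem mul_edge {a : LeavittPathAlgebra K E} (ha : IsEventuallyReal a) (e : E.Edge) :
    IsEventuallyReal (a * LeavittPathAlgebra.edge K e) := by
  cases ha with
  | of_isReal h => exact .of_isReal (h.mul_edge e)
  | of_mul_edge h => exact h e

/-- The summands may need paths of different lengths, but extra edges on the right do no harm. -/
theorem add {a b : LeavittPathAlgebra K E} (ha : IsEventuallyReal a) (hb : IsEventuallyReal b) :
    IsEventuallyReal (a + b) := by
  induction ha generalizing b with
  | @of_isReal a ha =>
    induction hb generalizing a with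
    | of_isReal hb => exact .of_isReal (ha.add hb)
    | of_mul_edge hb ih =>
      refine .of_mul_edge fun e => ?_
      rw [add_mul]
      exact ih e (ha.mul_edge e)
  | of_mul_edge ha ih =>
    refine .of_mul_edge fun e => ?_
    rw [add_mul]
    exact ih e (hb.mul_edge e)

theorem smul {a : LeavittPathAlgebra K E} (c : K) (ha : IsEventuallyReal a) :
    IsEventuallyReal (c • a) := by
  induction ha with
  | of_isReal ha => exact .of_isReal (ha.smul c)
  | of_mul_edge ha ih => exact .of_mul_edge fun e => by rw [smul_mul_assoc]; exact ih e

theorem vert_mul {a : LeavittPathAlgebra K E} (ha : IsEventuallyReal a) (x : E.Vert) :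
    IsEventuallyReal (vert K x * a) := by
  induction ha with
  | of_isReal ha => exact .of_isReal (ha.vert_mul x)
  | of_mul_edge ha ih => exact .of_mul_edge fun e => by rw [mul_assoc]; exact ih e

theorem edge_mul {a : LeavittPathAlgebra K E} (ha : IsEventuallyReal a) (f : E.Edge) :
    IsEventuallyReal (edge K f * a) := by
  induction ha with
  | of_isReal ha => exact .of_isReal (ha.edge_mul f)
  | of_mul_edge ha ih => exact .of_mul_edge fun e => by rw [mul_assoc]; exact ih e

theorem ghost_mul {a : LeavittPathAlgebra K E} (ha : IsEventuallyReal a) (f : E.Edge) :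
    IsEventuallyReal (ghost K f * a) := by
  induction ha with
  | of_isReal ha => exact .of_mul_edge fun e => .of_isReal (ha.ghost_mul_mul_edge f e)
  | of_mul_edge ha ih => exact .of_mul_edge fun e => by rw [mul_assoc]; exact ih e

end IsEventuallyReal

/-- Each ghost edge in a word costs at most one more edge on the right. -/
theorem isEventuallyReal (a : LeavittPathAlgebra K E) : IsEventuallyReal a := by
  induction a using induction_on with
  | zero => exact .of_isReal .zero
  | add a b ha hb => exact ha.add hb
  | smul c a ha => exact ha.smul c
  | vert_ x => exact .of_isReal (.vert x)
  | edge_ e => exact .of_isReal (.edge e)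
  | ghost_ e =>
    rw [← ghost_mul_src]
    exact (IsEventuallyReal.of_isReal (.vert _)).ghost_mul e
  | vert_mul x a ha => exact ha.vert_mul x
  | edge_mul e a ha => exact ha.edge_mul e
  | ghost_mul e a ha => exact ha.ghost_mul e

/-- If every vertex emits at least two edges, then every nonzero element can be cut down to a
vertex. -/
theorem hasVertexMultiple (h2 : ∀ (x : E.Vert) (e : E.Edge), ∃ f, E.src f = x ∧ f ≠ e)
    (h1 : ∀ x, ∃ e, E.src e = x) {a : LeavittPathAlgebra K E} (ha : a ≠ 0) :
    HasVertexMultiple a := by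
  classical
  induction isEventuallyReal a with
  | @of_isReal a h =>
    rw [← sum_vert_mul a, Finset.sum_mul] at ha
    obtain ⟨x, -, hx⟩ := Finset.exists_ne_zero_of_sum_ne_zero ha
    exact (h.hasVertexMultiple h2 x hx).of_mul_left
  | @of_mul_edge a h ih =>
    -- Otherwise a = 0, since the sum of all e e* is the sum of the vertices, which is the identity.
    obtain ⟨e, he⟩ : ∃ e, a * edge K e ≠ 0 := by
      by_contra! h0
      apply ha
      rw [← mul_sum_vert a, Finset.mul_sum]
      refine Finset.sum_eq_zero fun x _ => ?_
      rw [← sum_edge_mul_ghost x (h1 x), Finset.mul_sum]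
      refine Finset.sum_eq_zero fun e _ => ?_
      rw [← mul_assoc, h0, zero_mul]
    exact (ih e he).of_mul_right

end Finite

end LeavittPathAlgebra

/-! ### Infinite idempotents -/

/-- An idempotent `e` with `e = b * a` and `a * b ≠ e` for some `a`, `b` in the corner of `e` is
infinite. -/
theorem isInfiniteIdempotent_of_mul_eq {R : Type u} [NonUnitalRing R] {e a b : R}
    (he : e * e = e) (hea : e * a = a) (hae : a * e = a) (heb : e * b = b) (hbe : b * e = b)
    (hba : b * a = e) (hab : a * b ≠ e) : IsInfiniteIdempotent e := by
  have hfix : ∀ {x : R}, x ∈ rightMultiples e → e * x = x := by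
    rintro _ ⟨y, rfl⟩
    simp [← mul_assoc, he]
  have hfix' : ∀ {x : R}, x ∈ rightMultiples (a * b) → a * (b * x) = x := by
    rintro _ ⟨y, rfl⟩
    simp only [AddMonoidHom.coe_mulLeft, mul_assoc]
    rw [← mul_assoc b a, hba, ← mul_assoc e, heb]
  -- The idempotents ab and e - ab are orthogonal with sum e; left multiplication by a maps eR onto
  -- abR, with inverse left multiplication by b.
  refine ⟨he, rightMultiples (a * b), rightMultiples (e - a * b),
    isRightIdeal_rightMultiples _, isRightIdeal_rightMultiples _, ?_, ?_, ?_, ?_⟩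
  · apply le_antisymm
    · refine sup_le ?_ ?_
      · rintro _ ⟨y, rfl⟩
        exact ⟨a * b * y, by simp [← mul_assoc, hea]⟩
      · rintro _ ⟨y, rfl⟩
        exact ⟨(e - a * b) * y, by simp [← mul_assoc, mul_sub, hea, he]⟩
    · rintro _ ⟨y, rfl⟩
      exact AddSubgroup.mem_sup.2 ⟨_, ⟨y, rfl⟩, _, ⟨y, rfl⟩, by simp [sub_mul]⟩
  · rw [eq_bot_iff]
    rintro x ⟨hx, y, rfl⟩
    have h := hfix' hx
    simp only [AddMonoidHom.coe_mulLeft] at h ⊢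
    have h0 : b * ((e - a * b) * y) = 0 := by
      rw [← mul_assoc, mul_sub, ← mul_assoc, hba, hbe, heb, sub_self, zero_mul]
    rw [h0, mul_zero] at h
    exact h.symm
  · intro h
    have h1 : e ∈ rightMultiples (a * b) := by
      rw [h]
      exact ⟨e, he⟩
    have := hfix' h1
    rw [hbe] at this
    exact hab this
  · refine ⟨⟨⟨fun x => ⟨a * x, a * x, ?_⟩, fun x => ⟨b * x, b * x, ?_⟩, ?_, ?_⟩, ?_⟩, ?_⟩
    · rw [AddMonoidHom.coe_mulLeft, ← mul_assoc, mul_assoc a, hba, hae]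
    · rw [AddMonoidHom.coe_mulLeft, ← mul_assoc, heb]
    · rintro ⟨x, hx⟩
      simp [← mul_assoc, hba, hfix hx]
    · rintro ⟨x, hx⟩
      simp [hfix' hx]
    · intro x y
      exact Subtype.ext (mul_add a (x : R) y)
    · intro x y c h
      simp [h, mul_assoc]

namespace LeavittPathAlgebra

variable {K : Type w} [Field K] {E : DirectedGraph.{u, v}}

/-! ### Simple and purely infinite Leavitt path algebras -/

variable (E) in
/-- Reachability of vertices along paths. -/
def Reaches : E.Vert → E.Vert → Prop :=
  Relation.ReflTransGen fun x y => ∃ e, E.src e = x ∧ E.rng e = y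

/-- A path from `x` to `y` and its ghost path. -/
theorem Reaches.exists_mul_eq_vert {x y : E.Vert} (h : Reaches E x y) :
    ∃ p q : LeavittPathAlgebra K E, vert K x * p = p ∧ p * vert K y = p ∧ vert K y * q = q ∧
      q * vert K x = q ∧ q * p = vert K y := by
  induction h with
  | refl => exact ⟨vert K x, vert K x, by simp⟩
  | tail _ h ih =>
    obtain ⟨e, rfl, rfl⟩ := h
    obtain ⟨p, q, h1, h2, h3, h4, h5⟩ := ih
    refine ⟨p * edge K e, ghost K e * q, ?_, ?_, ?_, ?_, ?_⟩
    · rw [← mul_assoc, h1]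
    · rw [mul_assoc, edge_mul_rng]
    · rw [← mul_assoc, rng_mul_ghost]
    · rw [mul_assoc, h4]
    · rw [mul_assoc, ← mul_assoc q, h5, src_mul_edge, ghost_mul_edge_self]

variable [Finite E.Vert] [Finite E.Edge]

theorem isSimpleRing_of_reaches [Nonempty E.Vert] (h1 : ∀ x, ∃ e, E.src e = x)
    (h2 : ∀ (x : E.Vert) (e : E.Edge), ∃ f, E.src f = x ∧ f ≠ e) (h : ∀ x y, Reaches E x y) :
    IsSimpleRing (LeavittPathAlgebra K E) := by
  have := Fintype.ofFinite E.Vert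
  have := Fintype.ofFinite E.Edge
  have hnt : Nontrivial (LeavittPathAlgebra K E) :=
    ⟨_, _, vert_ne_zero h1 (Classical.arbitrary E.Vert)⟩
  refine ⟨{ toNontrivial := inferInstance, eq_bot_or_eq_top := fun I => ?_ }⟩
  refine or_iff_not_imp_left.2 fun hI => ?_
  obtain ⟨a, haI, ha⟩ : ∃ a ∈ I, a ≠ 0 := by
    by_contra! h0
    exact hI (eq_bot_iff.2 fun a ha => (TwoSidedIdeal.mem_bot _).2 (h0 a ha))
  obtain ⟨x, y, v, hv⟩ := hasVertexMultiple h2 h1 ha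
  have hvI : vert K v ∈ I := by
    rw [← hv]
    exact I.mul_mem_right _ _ (I.mul_mem_left _ _ haI)
  rw [eq_top_iff]
  intro b _
  -- The vertices sum to the identity, and each u is q v p for a path p from v to u and its ghost q.
  rw [← sum_vert_mul b]
  refine I.mul_mem_right _ _ (sum_mem fun u _ => ?_)
  obtain ⟨p, q, h3, -, -, -, h7⟩ := (h v u).exists_mul_eq_vert (K := K)
  rw [← h7, ← h3]
  exact I.mul_mem_left _ _ (I.mul_mem_right _ _ hvI)

theorem isPurelyInfinite_of_reaches (h1 : ∀ x, ∃ e, E.src e = x)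
    (h2 : ∀ (x : E.Vert) (e : E.Edge), ∃ f, E.src f = x ∧ f ≠ e) (h : ∀ x y, Reaches E x y) :
    IsPurelyInfinite (LeavittPathAlgebra K E) := by
  have := Fintype.ofFinite E.Vert
  have := Fintype.ofFinite E.Edge
  intro I hI hne
  obtain ⟨a, haI, ha⟩ : ∃ a ∈ I, a ≠ 0 := by
    by_contra! h0
    exact hne (eq_bot_iff.2 fun a ha => h0 a ha)
  obtain ⟨x, y, v, hv⟩ := hasVertexMultiple h2 h1 ha
  obtain ⟨e, he⟩ := h1 v
  obtain ⟨f, hf, hfe⟩ := h2 v e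
  obtain ⟨p, q, -, hp, hq, hq', hqp⟩ := (h (E.rng e) v).exists_mul_eq_vert (K := K)
  -- P is a closed path at v through e and Q its ghost. Conjugation by the other edge f kills PQ but
  -- not v.
  obtain ⟨P, Q, hvP, hPv, hvQ, hQv, hQP, hPQ⟩ : ∃ P Q : LeavittPathAlgebra K E,
      vert K v * P = P ∧ P * vert K v = P ∧ vert K v * Q = Q ∧ Q * vert K v = Q ∧
      Q * P = vert K v ∧ P * Q ≠ vert K v := by
    refine ⟨edge K e * p, q * ghost K e, ?_, ?_, ?_, ?_, ?_, ?_⟩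
    · rw [← he, ← mul_assoc, src_mul_edge]
    · rw [mul_assoc, hp]
    · rw [← mul_assoc, hq]
    · rw [← he, mul_assoc, ghost_mul_src]
    · rw [mul_assoc, ← mul_assoc (ghost K e), ghost_mul_edge_self, ← mul_assoc, hq', hqp]
    · intro h0
      have := congr_arg (fun b => ghost K f * b * edge K f) h0
      simp only [mul_assoc] at this
      rw [← mul_assoc (ghost K f), ghost_mul_edge hfe, zero_mul, ← hf, src_mul_edge,
        ghost_mul_edge_self] at this
      exact vert_ne_zero h1 _ this.symm
  -- From x a y = v one gets an idempotent cd = a y v x in I that is equivalent to v; conjugating P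
  -- and Q by c and d then shows it to be infinite.
  obtain ⟨c, d, hc, hd, hdc, hcd⟩ : ∃ c d : LeavittPathAlgebra K E, c * vert K v = c ∧
      vert K v * d = d ∧ d * c = vert K v ∧ c * d ∈ I := by
    refine ⟨a * (y * vert K v), vert K v * x, ?_, ?_, ?_, ?_⟩
    · simp only [mul_assoc, vert_mul_self]
    · rw [← mul_assoc, vert_mul_self]
    · rw [mul_assoc, ← mul_assoc x, ← mul_assoc (x * a), hv, vert_mul_self, vert_mul_self]
    · rw [mul_assoc]
      exact hI a haI _
  have hdc' : ∀ z, d * (c * z) = vert K v * z := fun z => by rw [← mul_assoc, hdc]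
  have hvP' : ∀ z, vert K v * (P * z) = P * z := fun z => by rw [← mul_assoc, hvP]
  have hvQ' : ∀ z, vert K v * (Q * z) = Q * z := fun z => by rw [← mul_assoc, hvQ]
  have hPv' : ∀ z, P * (vert K v * z) = P * z := fun z => by rw [← mul_assoc, hPv]
  have hQP' : ∀ z, Q * (P * z) = vert K v * z := fun z => by rw [← mul_assoc, hQP]
  refine ⟨c * d, hcd, isInfiniteIdempotent_of_mul_eq (a := c * (P * d)) (b := c * (Q * d))
    ?_ ?_ ?_ ?_ ?_ ?_ ?_⟩
  iterate 6 simp only [mul_assoc, hdc', hd, hvP', hvQ', hQP']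
  intro h0
  have h3 := congr_arg (fun z => d * z * c) h0
  simp only [mul_assoc, hdc', hdc, hvP', hPv', hQv, vert_mul_self] at h3
  exact hPQ h3

end LeavittPathAlgebra

/-! ### Hopf graphs -/

section HopfGraph

variable {G : Type u} [Group G] {r : RamificationData G}

/-- The edges of the Hopf graph that leave a given vertex. -/
abbrev HopfStar (r : RamificationData G) : Type u := Σ c : G, Fin (r (ConjClasses.mk c))

/-- Both sides are the common out-degree; the left one sorts the directions by conjugacy class. -/
theorem finsum_ramification_eq [Finite G] :
    ∑ᶠ C : ConjClasses G, r C * C.carrier.ncard = Nat.card (HopfStar r) := by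
  classical
  have := Fintype.ofFinite G
  rw [finsum_eq_sum_of_fintype, Nat.card_eq_fintype_card, Fintype.card_sigma]
  simp only [Fintype.card_fin]
  rw [← Finset.sum_fiberwise Finset.univ (ConjClasses.mk (α := G))]
  refine Finset.sum_congr rfl fun C _ => ?_
  rw [Finset.sum_congr rfl (g := fun _ => r C) fun c hc => by rw [(Finset.mem_filter.1 hc).2],
    Finset.sum_const, smul_eq_mul, mul_comm, ← Set.ncard_coe_finset]
  congr 2
  ext c
  simp [ConjClasses.mem_carrier_iff_mk_eq]

theorem mem_ramificationSemigroup {c : G} (hc : 0 < r (ConjClasses.mk c)) :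
    c ∈ ramificationSemigroup G r :=
  Subsemigroup.subset_closure <| Set.mem_iUnion₂.2 ⟨_, hc, ConjClasses.mem_carrier_mk⟩

theorem HopfStar.fst_mem (s : HopfStar r) : s.1 ∈ ramificationSemigroup G r :=
  mem_ramificationSemigroup s.2.pos

/-- The edge of the Hopf graph that leaves `x` in a given direction. -/
def HopfStar.edge (s : HopfStar r) (x : G) : (hopfGraph G r).Edge := ⟨(x, s.1), s.2⟩

theorem exists_hopfStar_edge_eq (e : (hopfGraph G r).Edge) :
    ∃ (s : HopfStar r) (x : G), s.edge x = e :=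
  ⟨⟨e.1.2, e.2⟩, e.1.1, rfl⟩

theorem HopfStar.edge_injective (x : G) : Function.Injective fun s : HopfStar r => s.edge x := by
  rintro ⟨c, i⟩ ⟨d, j⟩ h
  obtain ⟨h1, h2⟩ := Sigma.mk.inj_iff.1 h
  obtain rfl : c = d := congr_arg Prod.snd h1
  obtain rfl := eq_of_heq h2
  rfl

theorem nonempty_hopfStar (hr : r ≠ 0) : Nonempty (HopfStar r) := by
  obtain ⟨C, hC⟩ := Function.ne_iff.1 hr
  induction C using Quotient.inductionOn with
  | h c => exact ⟨c, ⟨0, Nat.pos_of_ne_zero hC⟩⟩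

theorem Subsemigroup.inv_mem_of_finite [Finite G] (S : Subsemigroup G) {c : G} (hc : c ∈ S) :
    c⁻¹ ∈ S := by
  have hpow : ∀ n : ℕ, c ^ (n + 1) ∈ S := fun n => by
    induction n with
    | zero => simpa using hc
    | succ n ih => rw [pow_succ]; exact S.mul_mem ih hc
  -- The exponent is twice the order minus one: unlike the order minus one, it is positive even for
  -- c = 1, as a subsemigroup requires.
  have h1 : c⁻¹ = c ^ (orderOf c - 1 + orderOf c - 1 + 1) := by
    have := orderOf_pos c
    rw [inv_eq_iff_mul_eq_one, ← pow_succ', show orderOf c - 1 + orderOf c - 1 + 1 + 1 =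
      orderOf c + orderOf c by omega, pow_add, pow_orderOf_eq_one, one_mul]
  rw [h1]
  exact hpow _

/-- Each generator labels an edge out of every vertex, and products of generators correspond to
concatenated paths. -/
theorem reaches_hopfGraph (h : ramificationSemigroup G r = ⊤) (x y : G) :
    LeavittPathAlgebra.Reaches (hopfGraph G r) x y := by
  have key : ∀ g ∈ ramificationSemigroup G r, ∀ x : G,
      LeavittPathAlgebra.Reaches (hopfGraph G r) x (x * g) := by
    intro g hg
    induction hg using Subsemigroup.closure_induction with
    | mem c hc =>
      intro x
      obtain ⟨C, hC, hcC⟩ := Set.mem_iUnion₂.1 hc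
      obtain rfl := ConjClasses.mem_carrier_iff_mk_eq.1 hcC
      exact .single ⟨HopfStar.edge ⟨c, ⟨0, hC⟩⟩ x, rfl, rfl⟩
    | mul a b _ _ ha hb =>
      intro x
      rw [← mul_assoc]
      exact (ha x).trans (hb (x * a))
  simpa using key (x⁻¹ * y) (h ▸ Subsemigroup.mem_top _) x

end HopfGraph

open LeavittPathAlgebra in
theorem corollary3p5 {G : Type u} [Group G] [Finite G] (r : RamificationData G) (hr : r ≠ 0)
    (K : Type w) [Field K] :
    List.TFAE
      [IsPurelyInfinite (LeavittPathAlgebra K (hopfGraph G r)) ∧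
        IsSimpleRing (LeavittPathAlgebra K (hopfGraph G r)),
      IsSimpleRing (LeavittPathAlgebra K (hopfGraph G r)),
      ramificationSemigroup G r = ⊤ ∧ 2 ≤ ∑ᶠ C : ConjClasses G, r C * C.carrier.ncard] := by
  obtain ⟨s₀⟩ := nonempty_hopfStar hr
  have hV : Finite (hopfGraph G r).Vert := inferInstanceAs (Finite G)
  have hV' : Nonempty (hopfGraph G r).Vert := inferInstanceAs (Nonempty G)
  have hE : Finite (hopfGraph G r).Edge :=
    inferInstanceAs (Finite (Σ p : G × G, Fin (r (ConjClasses.mk p.2))))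
  have h1 : ∀ x, ∃ e, (hopfGraph G r).src e = x :=
    fun x => ⟨HopfStar.edge (G := G) s₀ x, rfl⟩
  tfae_have 1 → 2 := And.right
  tfae_have 2 → 3 := by
    intro hs
    refine ⟨?_, ?_⟩
    · by_contra hne
      -- The separated set is S itself: it is closed under inverses, so for a generator c, x c lies
      -- in S only if x does.
      refine not_isSimpleRing_of_component (K := K) (E := hopfGraph G r) h1
        (ramificationSemigroup G r : Set G) ⟨_, s₀.fst_mem⟩ (fun h => hne (SetLike.coe_injective h))
        ?_ hs
      intro e
      obtain ⟨s, x, rfl⟩ := exists_hopfStar_edge_eq e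
      refine ⟨fun hx => mul_mem (M := G) hx s.fst_mem, fun hx => ?_⟩
      have : x * s.1 * s.1⁻¹ ∈ ramificationSemigroup G r :=
        mul_mem (M := G) hx (Subsemigroup.inv_mem_of_finite _ s.fst_mem)
      rwa [mul_inv_cancel_right] at this
    · rw [finsum_ramification_eq]
      by_contra! hlt
      -- With at most one direction, and no sinks, the source map is bijective.
      have : Subsingleton (HopfStar r) := (Finite.card_le_one_iff_subsingleton).1 (by omega)
      refine not_isSimpleRing_of_bijective (K := K) ⟨?_, h1⟩ hs
      intro e f hef
      obtain ⟨s, x, rfl⟩ := exists_hopfStar_edge_eq e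
      obtain ⟨t, y, rfl⟩ := exists_hopfStar_edge_eq f
      obtain rfl : x = y := hef
      rw [Subsingleton.elim s t]
  tfae_have 3 → 1 := by
    rintro ⟨hS, h⟩
    rw [finsum_ramification_eq] at h
    have : Nontrivial (HopfStar r) := Finite.one_lt_card_iff_nontrivial.1 h
    have h2 : ∀ (x : G) (e : (hopfGraph G r).Edge),
        ∃ f, (hopfGraph G r).src f = x ∧ f ≠ e := by
      intro x e
      obtain ⟨s, y, rfl⟩ := exists_hopfStar_edge_eq e
      obtain ⟨t, ht⟩ := exists_ne s
      refine ⟨HopfStar.edge (G := G) t x, rfl, fun h => ht ?_⟩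
      obtain rfl : x = y := congr_arg (hopfGraph G r).src h
      exact HopfStar.edge_injective (G := G) x h
    exact ⟨isPurelyInfinite_of_reaches h1 h2 (reaches_hopfGraph (G := G) hS),
      isSimpleRing_of_reaches h1 h2 (reaches_hopfGraph (G := G) hS)⟩
  tfae_finish
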